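/- Identify Turing machines with partial computable functions. A \emph{prefix-free machine} is a partial computable function $U(p,y)$ from pairs of binary strings to binary strings such that, whenever $U(p,y)$ halts, $U(q,y)$ halts for no proper prefix $q$ of $p$. Put $K_U(x|y)=\min\{|p| : U(p,y)=x\}$ (with $\min\emptyset=\infty$) and $K_U(x)=K_U(x|\varepsilon)$, where $\varepsilon$ is the empty string. A prefix-free machine $V$ is \emph{optimal} if for every prefix-free machine $U$ there is a constant $d$ with $K_V(x|y)\le K_U(x|y)+d$ for all $x,y$. Fix an optimal prefix-free machine $V$, write $K=K_V$, and let $K(n)$, for a natural number $n$, be $K(e(n))$, where $e$ is any fixed computable injective map from the natural numbers to binary strings. A set of strings is \emph{co-enumerable} if its complement is computably enumerable. For an integer $c$ let $$R_c=\{x : K(x)\ge K(|x|)+|x|-c\}.$$ \textbf{Corollary.} For all sufficiently large $c$ (that is, for all $c\ge c_0$, where $c_0$ depends only on $V$ and $e$), the set $R_c$ is not co-enumerable. Moreover, $R_c$ is not co-enumerable for every integer $c$ for which $R_c$ contains at least one string of every sufficiently large length. -/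

import Mathlib

/-- Binary strings. -/
abbrev BStr : Type := List Bool

/-- A prefix-free machine with two inputs, a program `p` and a condition `y`: a partial computable
function `U` such that, for every condition `y`, if `U p y` halts then `U q y` halts for no proper
prefix `q` of `p`. -/
structure IsPrefixFreeMachine (U : BStr → BStr →. BStr) : Prop where
  partrec : Partrec₂ U
  prefixFree : ∀ p q y : BStr, (U p y).Dom → (U q y).Dom → q <+: p → q = p

/-- The complexity `K_U(x|y)`: the minimal length of a program `p` with `U(p,y) = x`
(and `⊤` if there is no such program). -/
noncomputable def condComplexity (U : BStr → BStr →. BStr) (x y : BStr) : ℕ∞ :=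
  ⨅ (p : BStr) (_ : x ∈ U p y), (p.length : ℕ∞)

/-- The unconditional complexity `K_U(x)`, where the condition is the empty string. -/
noncomputable def complexity (U : BStr → BStr →. BStr) (x : BStr) : ℕ∞ :=
  condComplexity U x []

/-- `V` is an optimal prefix-free machine: a prefix-free machine whose complexity is minimal, up to
an additive constant, among the complexities of all prefix-free machines. -/
structure IsOptimalPrefixFreeMachine (V : BStr → BStr →. BStr) : Prop where
  isPrefixFree : IsPrefixFreeMachine V
  optimal : ∀ U : BStr → BStr →. BStr, IsPrefixFreeMachine U →
    ∃ d : ℕ, ∀ x y : BStr, condComplexity V x y ≤ condComplexity U x y + d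

/-- For an optimal machine the complexity of every string is finite, so `(complexity V x).toNat`
is the true minimum of the lengths of the programs for `x`. -/
theorem IsOptimalPrefixFreeMachine.complexity_ne_top {V : BStr → BStr →. BStr}
    (hV : IsOptimalPrefixFreeMachine V) (x : BStr) : complexity V x ≠ ⊤ := by
  -- the machine that outputs `x` on the empty program and diverges on all others
  let U : BStr → BStr →. BStr := fun p _ => ((if p = [] then some x else none : Option BStr))
  have hdom : ∀ p y, (U p y).Dom → p = [] := by
    intro p y h
    by_contra hp
    simp [U, hp] at h
  have hU : IsPrefixFreeMachine U := by
    refine ⟨?_, fun p q y hp hq _ => (hdom q y hq).trans (hdom p y hp).symm⟩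
    refine Computable.ofOption (f := fun a : BStr × BStr => if a.1 = [] then some x else none) ?_
    exact (Primrec.ite (Primrec.eq.comp Primrec.fst (Primrec.const []))
      (Primrec.const _) (Primrec.const _)).to_comp
  obtain ⟨d, hd⟩ := hV.optimal U hU
  have h0 : condComplexity U x [] ≤ 0 := by
    refine (iInf₂_le ([] : BStr) ?_).trans ?_
    · simp [U]
    · simp
  have h1 : complexity V x ≤ d := by
    refine (hd x []).trans ?_
    calc condComplexity U x [] + d ≤ 0 + d := by gcongr
      _ = d := zero_add _
  exact ne_top_of_le_ne_top (ENat.natCast_ne_top d) h1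

/-- The set of strings `x` with `K_V(x) ≥ K_V(|x|) + |x| - c`, where a natural number `n` is
represented by the string `e n`. -/
def maximalComplexitySet (V : BStr → BStr →. BStr) (e : ℕ → BStr) (c : ℤ) : Set BStr :=
  {x | ((complexity V x).toNat : ℤ) ≥
    ((complexity V (e x.length)).toNat : ℤ) + (x.length : ℤ) - c}

/-- A set of strings is co-enumerable if its complement is (computably) enumerable. -/
def CoEnumerable (S : Set BStr) : Prop :=
  REPred fun x : BStr => x ∉ S

/-! Let `A` be co-enumerable with a string of every length `n ≥ N`, and suppose K(x) + C ≥ K(|x|) +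
|x| on `A`. A game then refutes this. Fix a length `n` and request short programs for its strings
one by one. If the current string really stays in `A`, its low complexity forces K(n) to be small,
so waiting always reveals one of two enumerable events: the string leaves `A`, or `n` becomes cheap.
Not every string of length `n` can leave, so some request makes `n` cheap, and play moves to the
next length.

The strings of one length are split into 2^E equal levels (E = `excess`), with requests one bit
shorter at each level. The total spent up to level ℓ is dominated by level ℓ itself, namely at most
2^(ℓ+1-b) with b = `budget`, while cheapness at that level means K(n) ≤ b-2-ℓ. A finished round thus
costs at most half of 2^(-K(n)), and by Kraft all finished rounds cost at most 1/2. The unfinished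
round costs at most 1/2 because b = 2^E + 1. Hence the requests can always be served (Kraft–Chaitin,
`exists_prefixFreeMachine_of_requests`). Each finished length has K(n) ≤ b, so Kraft bounds the
number of rounds and hence of moves, although the game never stops: a contradiction
(`exists_complexity_add_lt`).

For large c the set meets every length (`exists_mem_maximalComplexitySet`): if all strings of length
n have complexity at most n + k, they carry Kraft weight at least 2^(-k). These weights sum to at
most 1 over n, so Kraft–Chaitin gives K(n) ≤ k + O(1). -/

/-! ### Strings as binary numbers -/

/-- The number written in binary (most significant digit first) by a string. -/
def binVal (w : BStr) : ℕ := w.foldl (fun v b => 2 * v + b.toNat) 0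

theorem binVal_concat (u : BStr) (b : Bool) : binVal (u ++ [b]) = 2 * binVal u + b.toNat := by
  simp [binVal]

theorem binVal_append (u w : BStr) :
    binVal (u ++ w) = binVal u * 2 ^ w.length + binVal w := by
  induction w using List.reverseRecOn with
  | nil => simp [binVal]
  | append_singleton w b ih =>
    rw [← List.append_assoc, binVal_concat, binVal_concat, ih, List.length_append, pow_add]
    simp; ring

theorem binVal_lt (w : BStr) : binVal w < 2 ^ w.length := by
  induction w using List.reverseRecOn with
  | nil => simp [binVal]
  | append_singleton w b ih =>
    rw [binVal_concat, List.length_append, pow_add]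
    have := b.toNat_le
    simp; omega

theorem exists_binVal_eq (n : ℕ) : ∀ v < 2 ^ n, ∃ w : BStr, w.length = n ∧ binVal w = v := by
  induction n with
  | zero => intro v hv; exact ⟨[], rfl, by simp at hv; simp [binVal, hv]⟩
  | succ n ih =>
    intro v hv
    obtain ⟨w, hw, hv'⟩ := ih (v / 2) (by rw [pow_succ] at hv; omega)
    refine ⟨w ++ [decide (v % 2 = 1)], by simp [hw], ?_⟩
    rw [binVal_concat, hv']
    rcases Nat.mod_two_eq_zero_or_one v with h | h <;> simp [h] <;> omega

theorem primrec_binVal : Primrec binVal := by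
  refine Primrec.list_foldl (α := BStr) (f := id) (g := fun _ => 0)
    (h := fun _ a => 2 * a.1 + a.2.toNat) Primrec.id (Primrec.const 0) ?_
  exact (Primrec.nat_add.comp (Primrec.nat_mul.comp (Primrec.const 2)
    (Primrec.fst.comp Primrec.snd))
    ((Primrec.dom_bool Bool.toNat).comp (Primrec.snd.comp Primrec.snd)))

theorem primrec_two_pow : Primrec (fun n : ℕ => 2 ^ n) := by
  refine (Primrec.nat_rec₁ (f := fun _ m => 2 * m) 1
    ((Primrec.nat_mul.comp (Primrec.const 2) Primrec.snd))).of_eq fun n => ?_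
  induction n with
  | zero => rfl
  | succ n ih => simp only [ih, pow_succ]; ring

/-! ### Kraft–Chaitin: serving requests by consecutive intervals -/

/-- The binary weight of a request to describe a string by a program of a given length. -/
noncomputable def requestWeight : Option (BStr × ℕ) → ℝ
  | none => 0
  | some r => (1 / 2) ^ r.2

theorem requestWeight_nonneg (o : Option (BStr × ℕ)) : 0 ≤ requestWeight o := by
  cases o <;> simp [requestWeight]

/-- Add the weight of a request to a dyadic rational `s.1 / 2 ^ s.2`. -/
def addRequest (s : ℕ × ℕ) (o : Option (BStr × ℕ)) : ℕ × ℕ :=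
  o.elim s fun r => (s.1 * 2 ^ r.2 + 2 ^ s.2, s.2 + r.2)

/-- The real number `s.1 / 2 ^ s.2`. -/
noncomputable def dyadicVal (s : ℕ × ℕ) : ℝ := s.1 / 2 ^ s.2

theorem dyadicVal_addRequest (s : ℕ × ℕ) (o : Option (BStr × ℕ)) :
    dyadicVal (addRequest s o) = dyadicVal s + requestWeight o := by
  cases o with
  | none => simp [addRequest, requestWeight]
  | some r =>
    simp only [addRequest, requestWeight, dyadicVal, Option.elim]
    push_cast
    rw [pow_add, one_div, inv_pow]
    field_simp

/-- The total weight of the first `t` requests, where later requests are undefined if some earlier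
request is. -/
def allocation (q : ℕ →. Option (BStr × ℕ)) (t : ℕ) : Part (ℕ × ℕ) :=
  t.rec (Part.some (0, 0)) fun t IH => IH.bind fun s => (q t).map (addRequest s)

/-- The answer to the program `w` that is due to the request `o`, served in the interval that starts
at `s`. -/
def serve (w : BStr) (s : ℕ × ℕ) (o : Option (BStr × ℕ)) : Option BStr :=
  o.bind fun r =>
    if w.length = r.2 + 1 ∧ s.1 * 2 ^ (r.2 + 1) ≤ binVal w * 2 ^ s.2 ∧
      (binVal w + 1) * 2 ^ s.2 ≤ s.1 * 2 ^ (r.2 + 1) + 2 ^ (s.2 + 1) then some r.1 else none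

/-- The interval of `[0, 1)` of the strings extending `w` is contained in the interval of
the request. -/
theorem serve_eq_some_iff {w : BStr} {s : ℕ × ℕ} {o : Option (BStr × ℕ)} {x : BStr} :
    serve w s o = some x ↔ ∃ k, o = some (x, k) ∧ w.length = k + 1 ∧
      dyadicVal s ≤ binVal w / 2 ^ w.length ∧
      (binVal w + 1) / 2 ^ w.length ≤ dyadicVal s + requestWeight o := by
  cases o with
  | none => simp [serve]
  | some r =>
    obtain ⟨x', k⟩ := r
    have h1 : s.1 * 2 ^ (k + 1) ≤ binVal w * 2 ^ s.2 ↔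
        dyadicVal s ≤ binVal w / 2 ^ (k + 1) := by
      rw [dyadicVal, div_le_div_iff₀ (by positivity) (by positivity)]
      exact_mod_cast Iff.rfl
    have h2 : (binVal w + 1) * 2 ^ s.2 ≤ s.1 * 2 ^ (k + 1) + 2 ^ (s.2 + 1) ↔
        ((binVal w : ℝ) + 1) / 2 ^ (k + 1) ≤ dyadicVal s + requestWeight (some (x', k)) := by
      have : dyadicVal s + requestWeight (some (x', k)) =
          (s.1 * 2 ^ (k + 1) + 2 ^ (s.2 + 1)) / (2 ^ s.2 * 2 ^ (k + 1)) := by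
        simp only [dyadicVal, requestWeight]
        rw [one_div, inv_pow]
        field_simp
        ring
      rw [this, div_le_div_iff₀ (by positivity) (by positivity), mul_comm ((2 : ℝ) ^ s.2),
        ← mul_assoc, mul_right_comm, mul_le_mul_iff_left₀ (by positivity)]
      exact_mod_cast Iff.rfl
    simp only [serve, Option.bind_some, Option.ite_none_right_eq_some, Option.some.injEq,
      Prod.mk.injEq, h1, h2]
    constructor
    · rintro ⟨⟨hl, ha, hb⟩, rfl⟩
      exact ⟨k, ⟨rfl, rfl⟩, hl, by rwa [hl], by rwa [hl]⟩
    · rintro ⟨k', ⟨rfl, rfl⟩, hl, ha, hb⟩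
      rw [hl] at ha hb
      exact ⟨⟨hl, ha, hb⟩, rfl⟩

theorem allocation_succ {q : ℕ →. Option (BStr × ℕ)} {t : ℕ} {s' : ℕ × ℕ} :
    s' ∈ allocation q (t + 1) ↔ ∃ s ∈ allocation q t, ∃ o ∈ q t, addRequest s o = s' := by
  simp [allocation]

/-- Intervals are laid end to end, so those of different times do not overlap. -/
theorem dyadicVal_le_of_allocation {q : ℕ →. Option (BStr × ℕ)} {t : ℕ} {s : ℕ × ℕ}
    {o : Option (BStr × ℕ)} (hs : s ∈ allocation q t) (ho : o ∈ q t) {t' : ℕ} {s' : ℕ × ℕ}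
    (hs' : s' ∈ allocation q t') (h : t < t') : dyadicVal s + requestWeight o ≤ dyadicVal s' := by
  induction t' generalizing s' with
  | zero => omega
  | succ t' ih =>
    obtain ⟨u, hu, o', ho', rfl⟩ := allocation_succ.1 hs'
    rw [dyadicVal_addRequest]
    rcases Nat.lt_succ_iff_lt_or_eq.1 h with h | rfl
    · linarith [ih hu h, requestWeight_nonneg o']
    · rw [Part.mem_unique hu hs, Part.mem_unique ho' ho]

theorem exists_mem_allocation {q : ℕ →. Option (BStr × ℕ)} {g : ℕ → Option (BStr × ℕ)} (t : ℕ)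
    (hg : ∀ t' < t, g t' ∈ q t') :
    ∃ s ∈ allocation q t, dyadicVal s = ∑ t' ∈ Finset.range t, requestWeight (g t') := by
  induction t with
  | zero => exact ⟨(0, 0), by simp [allocation], by simp [dyadicVal]⟩
  | succ t ih =>
    obtain ⟨s, hs, hsum⟩ := ih fun t' h => hg t' (by omega)
    refine ⟨_, allocation_succ.2 ⟨s, hs, g t, hg t (by omega), rfl⟩, ?_⟩
    rw [dyadicVal_addRequest, hsum, Finset.sum_range_succ]

/-- The answer to `w` at time `t`. -/
def serveAt (q : ℕ →. Option (BStr × ℕ)) (w : BStr) (t : ℕ) : Part (Option BStr) :=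
  (allocation q t).bind fun s => (q t).map fun o => serve w s o

theorem mem_serveAt {q : ℕ →. Option (BStr × ℕ)} {w : BStr} {t : ℕ} {a : Option BStr} :
    a ∈ serveAt q w t ↔ ∃ s ∈ allocation q t, ∃ o ∈ q t, serve w s o = a := by
  simp [serveAt]

/-- The dyadic interval of an extension lies inside that of its prefix, while intervals served at
different times are disjoint. So the times agree, and then the single request fixes the length. -/
theorem eq_of_mem_serveAt {q : ℕ →. Option (BStr × ℕ)} {w w' : BStr} {t t' : ℕ} {x x' : BStr}
    (h : some x ∈ serveAt q w t) (h' : some x' ∈ serveAt q w' t') (hw : w <+: w') :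
    t = t' ∧ w = w' := by
  obtain ⟨s, hs, o, ho, hx⟩ := mem_serveAt.1 h
  obtain ⟨s', hs', o', ho', hx'⟩ := mem_serveAt.1 h'
  obtain ⟨k, hk, hl, h1, h2⟩ := serve_eq_some_iff.1 hx
  obtain ⟨k', hk', hl', h1', h2'⟩ := serve_eq_some_iff.1 hx'
  obtain ⟨u, rfl⟩ := hw
  have hval : (binVal (w ++ u) : ℝ) = binVal w * 2 ^ u.length + binVal u := by
    exact_mod_cast binVal_append w u
  have hu : (binVal u : ℝ) + 1 ≤ 2 ^ u.length := by exact_mod_cast binVal_lt u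
  have hlen : (2 : ℝ) ^ (w ++ u).length = 2 ^ w.length * 2 ^ u.length := by
    rw [List.length_append, pow_add]
  have hle : (binVal w : ℝ) / 2 ^ w.length ≤ binVal (w ++ u) / 2 ^ (w ++ u).length := by
    rw [hlen, div_le_div_iff₀ (by positivity) (by positivity), hval]
    have : (0 : ℝ) ≤ binVal u * 2 ^ w.length := by positivity
    nlinarith
  have hlt : (binVal (w ++ u) : ℝ) / 2 ^ (w ++ u).length < (binVal w + 1) / 2 ^ w.length := by
    rw [hlen, div_lt_div_iff₀ (by positivity) (by positivity), hval]
    have : (0 : ℝ) < 2 ^ w.length := by positivity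
    nlinarith
  have hlt' : (binVal (w ++ u) : ℝ) / 2 ^ (w ++ u).length <
      (binVal (w ++ u) + 1) / 2 ^ (w ++ u).length := by
    gcongr; linarith
  rcases lt_trichotomy t t' with htt | rfl | htt
  · linarith [dyadicVal_le_of_allocation hs ho hs' htt]
  · refine ⟨rfl, (List.prefix_append w u).eq_of_length ?_⟩
    obtain rfl := Part.mem_unique ho ho'
    rw [hk] at hk'
    simp only [Option.some.injEq, Prod.mk.injEq] at hk'
    rw [hl, hl', hk'.2]
  · linarith [dyadicVal_le_of_allocation hs' ho' hs htt]

/-- The machine that serves the requests `q` in turn. -/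
def servingMachine (q : ℕ →. Option (BStr × ℕ)) (w : BStr) : Part BStr :=
  (Nat.rfind fun t => (serveAt q w t).map Option.isSome).bind fun t =>
    (serveAt q w t).bind fun o => (o : Part BStr)

theorem exists_of_mem_servingMachine {q : ℕ →. Option (BStr × ℕ)} {w x : BStr}
    (h : x ∈ servingMachine q w) : ∃ t, some x ∈ serveAt q w t := by
  simp only [servingMachine, Part.mem_bind_iff] at h
  obtain ⟨t, -, o, ho, hx⟩ := h
  rw [Part.mem_ofOption] at hx
  exact ⟨t, by rwa [Option.mem_def.1 hx] at ho⟩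

theorem mem_servingMachine {q : ℕ →. Option (BStr × ℕ)} {w x : BStr} {t : ℕ}
    (h : some x ∈ serveAt q w t) (hdom : ∀ t' < t, (serveAt q w t').Dom) :
    x ∈ servingMachine q w := by
  have : t ∈ Nat.rfind fun t => (serveAt q w t).map Option.isSome := by
    refine Nat.mem_rfind.2 ⟨(Part.mem_map_iff _).2 ⟨_, h, rfl⟩, fun {t'} ht => ?_⟩
    have hm := Part.get_mem (hdom t' ht)
    refine (Part.mem_map_iff _).2 ⟨_, hm, ?_⟩
    cases hc : (serveAt q w t').get (hdom t' ht) with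
    | none => rfl
    | some y =>
      rw [hc] at hm
      exact absurd (eq_of_mem_serveAt hm h List.prefix_rfl).1 ht.ne
  rw [servingMachine]
  exact Part.mem_bind this (Part.mem_bind h (by simp))

/-- No bound on the total weight is needed: sequences that overflow or diverge do not spoil
prefix-freeness. -/
theorem prefix_eq_of_servingMachine {q : ℕ →. Option (BStr × ℕ)} {w w' : BStr}
    (h : (servingMachine q w).Dom) (h' : (servingMachine q w').Dom) (hw : w <+: w') : w = w' := by
  obtain ⟨t, ht⟩ := exists_of_mem_servingMachine (Part.get_mem h)
  obtain ⟨t', ht'⟩ := exists_of_mem_servingMachine (Part.get_mem h')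
  exact (eq_of_mem_serveAt ht ht' hw).2

theorem exists_mem_servingMachine {q : ℕ →. Option (BStr × ℕ)} {g : ℕ → Option (BStr × ℕ)}
    {t : ℕ} {x : BStr} {k : ℕ} (hg : ∀ t' ≤ t, g t' ∈ q t')
    (hsum : ∑ t' ∈ Finset.range (t + 1), requestWeight (g t') ≤ 1) (hx : g t = some (x, k)) :
    ∃ w : BStr, w.length = k + 1 ∧ x ∈ servingMachine q w := by
  obtain ⟨s, hs, hval⟩ := exists_mem_allocation t fun t' h => hg t' h.le
  rw [Finset.sum_range_succ, ← hval] at hsum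
  have hw : requestWeight (g t) * 2 ^ (k + 1) = 2 := by
    rw [hx, requestWeight, one_div, inv_pow, pow_succ]; field_simp
  have hpos : (0 : ℝ) < 2 ^ (k + 1) := by positivity
  have h0 : 0 ≤ dyadicVal s := by rw [dyadicVal]; positivity
  -- The interval of the request has length two in units of 2^(-(k+1)), so it contains a full unit
  -- starting at the first grid point. This is the reason for programs of length k + 1.
  set v := ⌈dyadicVal s * 2 ^ (k + 1)⌉₊ with hv
  have hv1 : dyadicVal s * 2 ^ (k + 1) ≤ v := Nat.le_ceil _
  have hv2 : (v : ℝ) < dyadicVal s * 2 ^ (k + 1) + 1 := Nat.ceil_lt_add_one (by positivity)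
  have hv3 : (v : ℝ) + 1 ≤ (dyadicVal s + requestWeight (g t)) * 2 ^ (k + 1) := by
    rw [add_mul, hw]; linarith
  have hv4 : v < 2 ^ (k + 1) := by
    have : (v : ℝ) < 2 ^ (k + 1) := by nlinarith
    exact_mod_cast this
  obtain ⟨w, hwl, hwv⟩ := exists_binVal_eq _ v hv4
  refine ⟨w, hwl, mem_servingMachine (t := t) ?_ fun t' ht' => ?_⟩
  · refine mem_serveAt.2 ⟨s, hs, g t, hg t le_rfl, serve_eq_some_iff.2 ⟨k, hx, hwl, ?_, ?_⟩⟩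
    · rw [hwl, hwv, le_div_iff₀ hpos]; exact hv1
    · rw [hwl, hwv, div_le_iff₀ hpos]; exact hv3
  · obtain ⟨s', hs', -⟩ := exists_mem_allocation t' fun u hu => hg u (by omega)
    exact Part.dom_iff_mem.2
      ⟨_, mem_serveAt.2 ⟨s', hs', g t', hg t' ht'.le, rfl⟩⟩

theorem computable_addRequest : Computable₂ addRequest := by
  refine Primrec.to_comp ?_
  have h1 : Primrec fun a : ((ℕ × ℕ) × Option (BStr × ℕ)) × (BStr × ℕ) => a.1.1.1 :=
    Primrec.fst.comp (Primrec.fst.comp Primrec.fst)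
  have h2 : Primrec fun a : ((ℕ × ℕ) × Option (BStr × ℕ)) × (BStr × ℕ) => a.1.1.2 :=
    Primrec.snd.comp (Primrec.fst.comp Primrec.fst)
  have h3 : Primrec fun a : ((ℕ × ℕ) × Option (BStr × ℕ)) × (BStr × ℕ) => a.2.2 :=
    Primrec.snd.comp Primrec.snd
  refine (Primrec.option_casesOn (f := fun a : (ℕ × ℕ) × Option (BStr × ℕ) => a.1)
    (g := fun a r => (a.1.1 * 2 ^ r.2 + 2 ^ a.1.2, a.1.2 + r.2)) Primrec.snd Primrec.fst
    (Primrec.pair (Primrec.nat_add.comp (Primrec.nat_mul.comp h1 (primrec_two_pow.comp h3))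
      (primrec_two_pow.comp h2)) (Primrec.nat_add.comp h2 h3))).of_eq ?_
  rintro ⟨s, _ | r⟩ <;> rfl

theorem computable_serve :
    Computable fun a : BStr × (ℕ × ℕ) × Option (BStr × ℕ) => serve a.1 a.2.1 a.2.2 := by
  refine Primrec.to_comp ?_
  have hw : Primrec fun a : (BStr × (ℕ × ℕ) × Option (BStr × ℕ)) × (BStr × ℕ) => a.1.1 := Primrec.fst.comp Primrec.fst
  have h1 : Primrec fun a : (BStr × (ℕ × ℕ) × Option (BStr × ℕ)) × (BStr × ℕ) => a.1.2.1.1 :=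
    Primrec.fst.comp (Primrec.fst.comp (Primrec.snd.comp Primrec.fst))
  have h2 : Primrec fun a : (BStr × (ℕ × ℕ) × Option (BStr × ℕ)) × (BStr × ℕ) => a.1.2.1.2 :=
    Primrec.snd.comp (Primrec.fst.comp (Primrec.snd.comp Primrec.fst))
  have h3 : Primrec fun a : (BStr × (ℕ × ℕ) × Option (BStr × ℕ)) × (BStr × ℕ) => a.2.2 + 1 := Primrec.succ.comp (Primrec.snd.comp Primrec.snd)
  have hv : Primrec fun a : (BStr × (ℕ × ℕ) × Option (BStr × ℕ)) × (BStr × ℕ) => binVal a.1.1 := primrec_binVal.comp hw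
  have hs : Primrec fun a : (BStr × (ℕ × ℕ) × Option (BStr × ℕ)) × (BStr × ℕ) => a.1.2.1.1 * 2 ^ (a.2.2 + 1) :=
    Primrec.nat_mul.comp h1 (primrec_two_pow.comp h3)
  have h4 : PrimrecPred fun a : (BStr × (ℕ × ℕ) × Option (BStr × ℕ)) × (BStr × ℕ) =>
      a.1.2.1.1 * 2 ^ (a.2.2 + 1) ≤ binVal a.1.1 * 2 ^ a.1.2.1.2 :=
    Primrec.nat_le.comp hs (Primrec.nat_mul.comp hv (primrec_two_pow.comp h2))
  have h5 : PrimrecPred fun a : (BStr × (ℕ × ℕ) × Option (BStr × ℕ)) × (BStr × ℕ) =>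
      (binVal a.1.1 + 1) * 2 ^ a.1.2.1.2 ≤
        a.1.2.1.1 * 2 ^ (a.2.2 + 1) + 2 ^ (a.1.2.1.2 + 1) :=
    Primrec.nat_le.comp (Primrec.nat_mul.comp (Primrec.succ.comp hv)
      (primrec_two_pow.comp h2)) (Primrec.nat_add.comp hs (primrec_two_pow.comp
      (Primrec.succ.comp h2)))
  have h6 : PrimrecPred fun a : (BStr × (ℕ × ℕ) × Option (BStr × ℕ)) × (BStr × ℕ) =>
      a.1.1.length = a.2.2 + 1 := Primrec.eq.comp (Primrec.list_length.comp hw) h3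
  have h7 : Primrec fun a : (BStr × (ℕ × ℕ) × Option (BStr × ℕ)) × (BStr × ℕ) => some a.2.1 :=
    Primrec.option_some.comp (Primrec.fst.comp Primrec.snd)
  have h8 := Primrec.ite (h6.and (h4.and h5)) h7 (Primrec.const none)
  exact Primrec.option_bind (Primrec.snd.comp Primrec.snd) h8.to₂

theorem partrec_allocation {q : ℕ → ℕ →. Option (BStr × ℕ)} (hq : Partrec₂ q) :
    Partrec₂ fun d t => allocation (q d) t := by
  refine Partrec.nat_rec (f := fun a : ℕ × ℕ => a.2) (g := fun _ => Part.some (0, 0))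
    (h := fun a b => (q a.1 b.1).map (addRequest b.2)) Computable.snd
    (Computable.const _).partrec ?_
  refine Partrec.map (hq.comp (Computable.fst.comp Computable.fst)
    (Computable.fst.comp Computable.snd)) ?_
  exact computable_addRequest.comp (Computable.snd.comp (Computable.snd.comp Computable.fst))
    Computable.snd

theorem partrec_serveAt {q : ℕ → ℕ →. Option (BStr × ℕ)} (hq : Partrec₂ q) :
    Partrec fun a : (ℕ × BStr) × ℕ => serveAt (q a.1.1) a.1.2 a.2 := by
  have h1 : Partrec fun a : (ℕ × BStr) × ℕ => allocation (q a.1.1) a.2 :=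
    (partrec_allocation hq).comp (Computable.fst.comp Computable.fst) Computable.snd
  have h2 : Partrec fun a : ((ℕ × BStr) × ℕ) × (ℕ × ℕ) => q a.1.1.1 a.1.2 :=
    hq.comp (Computable.fst.comp (Computable.fst.comp Computable.fst))
      (Computable.snd.comp Computable.fst)
  have h3 : Computable fun a : (((ℕ × BStr) × ℕ) × (ℕ × ℕ)) × Option (BStr × ℕ) =>
      (a.1.1.1.2, a.1.2, a.2) :=
    Computable.pair (Computable.snd.comp (Computable.fst.comp
      (Computable.fst.comp Computable.fst)))
      (Computable.pair (Computable.snd.comp Computable.fst) Computable.snd)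
  have h4 : Computable fun a : (((ℕ × BStr) × ℕ) × (ℕ × ℕ)) × Option (BStr × ℕ) =>
      serve a.1.1.1.2 a.1.2 a.2 := (computable_serve.comp h3).of_eq fun _ => rfl
  have h5 : Partrec₂ fun (a : (ℕ × BStr) × ℕ) (s : ℕ × ℕ) =>
      (q a.1.1 a.2).map fun o => serve a.1.2 s o := h2.map h4.to₂
  exact h1.bind h5

theorem partrec_servingMachine {q : ℕ → ℕ →. Option (BStr × ℕ)} (hq : Partrec₂ q) :
    Partrec₂ fun (d : ℕ) (w : BStr) => servingMachine (q d) w := by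
  refine Partrec.bind (Partrec.rfind ?_) ?_
  · exact Partrec.map (partrec_serveAt hq) (Primrec.option_isSome.to_comp.comp Computable.snd)
  · exact Partrec.bind (partrec_serveAt hq) (Computable.ofOption Computable.snd)

theorem idxOf_true_of_prefix {p p' : BStr} (h : true ∈ p) (hp : p <+: p') :
    p'.idxOf true = p.idxOf true := by
  obtain ⟨u, rfl⟩ := hp
  exact List.idxOf_append_of_mem h

/-- The Kraft–Chaitin theorem, for a uniformly computable family of sequences of requests: a single
prefix-free machine serves the `d`-th sequence as long as its total weight is at most one, with
programs longer than requested by `d + 2`. -/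
theorem exists_prefixFreeMachine_of_requests {q : ℕ → ℕ →. Option (BStr × ℕ)} (hq : Partrec₂ q) :
    ∃ U, IsPrefixFreeMachine U ∧ ∀ (d t : ℕ) (g : ℕ → Option (BStr × ℕ)) (x : BStr) (k : ℕ),
      (∀ t' ≤ t, g t' ∈ q d t') → ∑ t' ∈ Finset.range (t + 1), requestWeight (g t') ≤ 1 →
      g t = some (x, k) → complexity U x ≤ ((d + k + 2 : ℕ) : ℕ∞) := by
  -- Served programs have length at least 1. A program without `true` has `idxOf true` equal to its
  -- length and so is left with the empty remainder, on which the machine must diverge.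
  have hnil : ∀ d, ¬ (servingMachine (q d) []).Dom := by
    intro d h
    obtain ⟨t, ht⟩ := exists_of_mem_servingMachine (Part.get_mem h)
    obtain ⟨s, -, o, -, hx⟩ := mem_serveAt.1 ht
    obtain ⟨k, -, hl, -⟩ := serve_eq_some_iff.1 hx
    simp at hl
  -- A program has the form 0^d 1 w: the self-delimiting header selects the sequence, and w is run
  -- on it. The header costs d + 1 bits and w has k + 1.
  refine ⟨fun p _ => servingMachine (q (p.idxOf true)) (p.drop (p.idxOf true + 1)), ⟨?_, ?_⟩, ?_⟩
  · have hi : Computable fun a : BStr × BStr => a.1.idxOf true :=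
      (Primrec.list_idxOf.comp (Primrec.const true) Primrec.fst).to_comp
    refine (partrec_servingMachine hq).comp hi ?_
    exact Primrec.list_drop.to_comp.comp (Computable.succ.comp hi) Computable.fst
  · intro p' p _ hp' hp hpp
    replace hp : (servingMachine (q (p.idxOf true)) (p.drop (p.idxOf true + 1))).Dom := hp
    replace hp' : (servingMachine (q (p'.idxOf true)) (p'.drop (p'.idxOf true + 1))).Dom := hp'
    have hmem : true ∈ p := by
      by_contra hn
      rw [List.idxOf_eq_length hn, List.drop_eq_nil_of_le (by omega)] at hp
      exact hnil _ hp
    rw [idxOf_true_of_prefix hmem hpp] at hp'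
    obtain ⟨u, rfl⟩ := hpp
    have hlt := List.idxOf_lt_length_of_mem hmem
    rw [List.drop_append_of_le_length hlt] at hp'
    have := prefix_eq_of_servingMachine hp hp' (List.prefix_append _ _)
    simpa using this
  · intro d t g x k hg hsum hx
    obtain ⟨w, hw, hxw⟩ := exists_mem_servingMachine hg hsum hx
    have hidx : (List.replicate d false ++ true :: w).idxOf true = d := by
      rw [List.idxOf_append_of_notMem (by simp)]; simp
    refine (iInf₂_le (List.replicate d false ++ true :: w) ?_).trans ?_
    · change x ∈ servingMachine (q _) (List.drop (List.idxOf true _ + 1) _)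
      rw [hidx, List.drop_append]
      simpa using hxw
    · simp only [List.length_append, List.length_replicate, List.length_cons, hw]
      exact_mod_cast (by omega)

/-! ### Closure properties of enumerable predicates -/

section Enumerability

variable {α β : Type*} [Primcodable α] [Primcodable β]

/-- An enumerable predicate has a computable enumeration in which every element appears at exactly
one stage. -/
theorem REPred.exists_stage {p : α → Prop} (hp : REPred p) :
    ∃ f : α → ℕ → Bool, Computable₂ f ∧ (∀ a, p a ↔ ∃ s, f a s = true) ∧
      ∀ a s s', f a s = true → f a s' = true → s = s' := by
  obtain ⟨c, hc⟩ := Nat.Partrec.Code.exists_code.1 hp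
  have hdom : ∀ a, p a ↔ ∃ s, (Nat.Partrec.Code.evaln s c (Encodable.encode a)).isSome := by
    intro a
    have h1 : p a ↔ (Nat.Partrec.Code.eval c (Encodable.encode a)).Dom := by
      rw [hc]
      simp only [Encodable.encodek, Part.coe_some, Part.bind_some]
      exact ⟨fun h => ⟨h, trivial⟩, fun h => h.1⟩
    rw [h1, Part.dom_iff_mem]
    simp only [Nat.Partrec.Code.evaln_complete, Option.isSome_iff_exists, Option.mem_def]
    exact exists_comm
  have hmono : ∀ {a : α} {s s' : ℕ}, s ≤ s' →
      (Nat.Partrec.Code.evaln s c (Encodable.encode a)).isSome →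
      (Nat.Partrec.Code.evaln s' c (Encodable.encode a)).isSome := by
    intro a s s' h hs
    obtain ⟨x, hx⟩ := Option.isSome_iff_exists.1 hs
    exact Option.isSome_iff_exists.2 ⟨x, Nat.Partrec.Code.evaln_mono h hx⟩
  have hev : Computable₂ fun (a : α) (s : ℕ) =>
      (Nat.Partrec.Code.evaln s c (Encodable.encode a)).isSome :=
    (Primrec.option_isSome.comp (Nat.Partrec.Code.primrec_evaln.comp
      (Primrec.pair (Primrec.pair Primrec.snd (Primrec.const c))
        (Primrec.encode.comp Primrec.fst)))).to_comp
  -- Stage s is the one where the bounded evaluation first succeeds with bound s + 1; with bound 0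
  -- it never succeeds.
  refine ⟨fun a s => (Nat.Partrec.Code.evaln (s + 1) c (Encodable.encode a)).isSome &&
    !(Nat.Partrec.Code.evaln s c (Encodable.encode a)).isSome, ?_, fun a => ?_, ?_⟩
  · exact (Primrec.and.to_comp).comp
      (hev.comp Computable.fst (Computable.succ.comp Computable.snd))
      (Primrec.not.to_comp.comp (hev.comp Computable.fst Computable.snd))
  · rw [hdom]
    constructor
    · intro h
      classical
      have hs := Nat.find_spec h
      cases hf : Nat.find h with
      | zero => rw [hf] at hs; simp [Nat.Partrec.Code.evaln] at hs
      | succ s =>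
        rw [hf] at hs
        have := Nat.find_min h (m := s) (by omega)
        exact ⟨s, by simp [hs, this]⟩
    · rintro ⟨s, hs⟩
      simp only [Bool.and_eq_true] at hs
      exact ⟨s + 1, hs.1⟩
  · have key : ∀ a s s', s < s' →
        (Nat.Partrec.Code.evaln (s + 1) c (Encodable.encode (a : α))).isSome →
        (Nat.Partrec.Code.evaln s' c (Encodable.encode a)).isSome :=
      fun a s s' h => hmono h
    intro a s s' h h'
    simp only [Bool.and_eq_true, Bool.not_eq_true'] at h h'
    rcases lt_trichotomy s s' with hlt | rfl | hlt
    · simp [key a s s' hlt h.1] at h'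
    · rfl
    · simp [key a s' s hlt h'.1] at h

theorem REPred.partrec_of_iff_dom {p : α → Prop} {f : α →. β} (hf : Partrec f)
    (h : ∀ a, (f a).Dom ↔ p a) : REPred p :=
  hf.dom_re.of_eq h

/-- Dovetailing: search over codes of pairs of a witness and a stage. -/
theorem REPred.exists {p : α → β → Prop} (hp : REPred fun ab : α × β => p ab.1 ab.2) :
    REPred fun a => ∃ b, p a b := by
  obtain ⟨f, hf, hfp, -⟩ := hp.exists_stage
  let g : α → ℕ → Bool := fun a t =>
    (Encodable.decode (α := β × ℕ) t).elim false fun bs => f (a, bs.1) bs.2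
  have hg : Computable₂ g := by
    have h2 : Computable₂ fun (at' : α × ℕ) (bs : β × ℕ) => f (at'.1, bs.1) bs.2 :=
      hf.comp (Computable.pair (Computable.fst.comp Computable.fst)
        (Computable.fst.comp Computable.snd)) (Computable.snd.comp Computable.snd)
    refine (Computable.option_casesOn (Computable.decode.comp Computable.snd)
      (Computable.const false) h2).of_eq ?_
    rintro ⟨a, t⟩
    simp only [g]
    cases (Encodable.decode t : Option (β × ℕ)) <;> rfl
  refine REPred.partrec_of_iff_dom (Partrec.rfind hg.partrec₂) fun a => ?_
  rw [Nat.rfind_dom]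
  constructor
  · rintro ⟨t, ht, -⟩
    have ht : g a t = true := by simpa using ht
    simp only [g] at ht
    cases hd : (Encodable.decode t : Option (β × ℕ)) with
    | none => simp [hd] at ht
    | some bs =>
      simp only [hd, Option.elim] at ht
      exact ⟨bs.1, (hfp (a, bs.1)).2 ⟨bs.2, ht⟩⟩
  · rintro ⟨b, hb⟩
    obtain ⟨s, hs⟩ := (hfp (a, b)).1 hb
    exact ⟨Encodable.encode (b, s), by simp [g, hs], fun {_} _ => trivial⟩

theorem REPred.forall_lt {p : α → ℕ → Prop} (hp : REPred fun ab : α × ℕ => p ab.1 ab.2) {f : α → ℕ}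
    (hf : Computable f) : REPred fun a => ∀ v < f a, p a v := by
  have h : Partrec fun a : α => ((f a).rec (Part.some ()) fun v IH => IH.bind fun _ =>
      Part.assert (p a v) fun _ => Part.some () : Part Unit) := by
    refine Partrec.nat_rec (g := fun _ => Part.some ())
      (h := fun a b => Part.assert (p a b.1) fun _ => Part.some ()) hf
      (Computable.const ()).partrec ?_
    exact Partrec.comp (f := fun ab : α × ℕ => Part.assert (p ab.1 ab.2) fun _ => Part.some ()) hp
      (Computable.pair Computable.fst (Computable.fst.comp Computable.snd))
  refine REPred.partrec_of_iff_dom h fun a => ?_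
  generalize f a = n
  induction n with
  | zero => simp
  | succ n ih =>
    rw [Nat.forall_lt_succ_right, ← ih]
    simp [Part.dom_iff_mem]

theorem REPred.comp {p : β → Prop} (hp : REPred p) {f : α → β} (hf : Computable f) :
    REPred fun a => p (f a) :=
  Partrec.comp hp hf

end Enumerability

/-! ### Listing the strings of a given length -/

/-- The string of length `n` that consists of the last `n` binary digits of `v`. -/
def bitString (n v : ℕ) : BStr := (List.range n).map fun k => v.testBit k

theorem length_bitString (n v : ℕ) : (bitString n v).length = n := by simp [bitString]

theorem bitString_injOn {n v v' : ℕ} (hv : v < 2 ^ n) (hv' : v' < 2 ^ n)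
    (h : bitString n v = bitString n v') : v = v' := by
  refine Nat.eq_of_testBit_eq fun i => ?_
  by_cases hi : i < n
  · have := congrArg (fun l => l[i]?) h
    simpa [bitString, hi] using this
  · have hp : 2 ^ n ≤ 2 ^ i := Nat.pow_le_pow_right (by norm_num) (by omega)
    rw [Nat.testBit_lt_two_pow (by omega), Nat.testBit_lt_two_pow (by omega)]

theorem exists_bitString_eq (x : BStr) : ∃ v < 2 ^ x.length, bitString x.length v = x := by
  let f : Fin (2 ^ x.length) → List.Vector Bool x.length :=
    fun v => ⟨bitString x.length v, length_bitString _ _⟩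
  have hf : Function.Injective f := fun v v' h =>
    Fin.ext (bitString_injOn v.2 v'.2 (congrArg Subtype.val h))
  obtain ⟨v, hv⟩ := ((Fintype.bijective_iff_injective_and_card f).2 ⟨hf, by simp⟩).2 ⟨x, rfl⟩
  exact ⟨v, v.2, congrArg Subtype.val hv⟩

theorem computable_bitString : Computable₂ bitString := by
  refine Primrec.to_comp (Primrec.list_map (Primrec.list_range.comp Primrec.fst) ?_)
  have hd : Primrec fun a : (ℕ × ℕ) × ℕ => a.1.2 / 2 ^ a.2 % 2 :=
    Primrec.nat_mod.comp (Primrec.nat_div.comp (Primrec.snd.comp Primrec.fst)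
      (primrec_two_pow.comp Primrec.snd)) (Primrec.const 2)
  refine (PrimrecPred.decide (Primrec.eq.comp hd (Primrec.const 1))).of_eq fun a => ?_
  exact Nat.testBit_eq_decide_div_mod_eq.symm

/-! ### Semicomputability and the Kraft inequality for K -/

section Complexity

variable {V : BStr → BStr →. BStr}

theorem IsOptimalPrefixFreeMachine.exists_program (hV : IsOptimalPrefixFreeMachine V) (x : BStr) :
    ∃ p, x ∈ V p [] ∧ p.length = (complexity V x).toNat := by
  by_contra! h
  have hne := hV.complexity_ne_top x
  obtain ⟨n, hn⟩ := ENat.ne_top_iff_exists.1 hne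
  have h1 : ((n + 1 : ℕ) : ℕ∞) ≤ complexity V x := by
    refine le_iInf₂ fun p hp => ?_
    have hle : complexity V x ≤ p.length := iInf₂_le p hp
    have hp' := h p hp
    rw [← hn] at hle hp'
    have hle : n ≤ p.length := by exact_mod_cast hle
    simp only [ENat.toNat_natCast] at hp'
    exact_mod_cast (by omega : n + 1 ≤ p.length)
  rw [← hn] at h1
  have : n + 1 ≤ n := by exact_mod_cast h1
  omega

theorem toNat_complexity_le {x p : BStr} (hp : x ∈ V p []) :
    (complexity V x).toNat ≤ p.length := by
  have h : complexity V x ≤ (p.length : ℕ∞) := iInf₂_le p hp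
  have := ENat.toNat_le_toNat h (ENat.natCast_ne_top _)
  simpa using this

theorem IsOptimalPrefixFreeMachine.toNat_complexity_le_iff (hV : IsOptimalPrefixFreeMachine V)
    {x : BStr} {b : ℕ} :
    (complexity V x).toNat ≤ b ↔ ∃ p : BStr, p.length ≤ b ∧ x ∈ V p [] := by
  constructor
  · intro h
    obtain ⟨p, hp, hl⟩ := hV.exists_program x
    exact ⟨p, hl ▸ h, hp⟩
  · rintro ⟨p, hl, hp⟩
    exact (toNat_complexity_le hp).trans hl

/-- Prefix complexity is upper semicomputable. -/
theorem IsOptimalPrefixFreeMachine.rePred_complexity_le (hV : IsOptimalPrefixFreeMachine V) :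
    REPred fun a : BStr × ℕ => (complexity V a.1).toNat ≤ a.2 := by
  refine REPred.of_eq (p := fun a : BStr × ℕ => ∃ p : BStr, p.length ≤ a.2 ∧ a.1 ∈ V p []) ?_
    fun a => hV.toNat_complexity_le_iff.symm
  refine REPred.exists ?_
  have h1 : Partrec fun a : (BStr × ℕ) × BStr => V a.2 [] :=
    hV.isPrefixFree.partrec.comp Computable.snd (Computable.const [])
  have h2 : Primrec fun a : ((BStr × ℕ) × BStr) × BStr =>
      if a.1.2.length ≤ a.1.1.2 ∧ a.2 = a.1.1.1 then some () else none :=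
    Primrec.ite ((Primrec.nat_le.comp (Primrec.list_length.comp (Primrec.snd.comp Primrec.fst))
      (Primrec.snd.comp (Primrec.fst.comp Primrec.fst))).and (Primrec.eq.comp Primrec.snd
      (Primrec.fst.comp (Primrec.fst.comp Primrec.fst)))) (Primrec.const _) (Primrec.const _)
  have h3 : Partrec₂ fun (a : (BStr × ℕ) × BStr) (z : BStr) =>
      ((if a.2.length ≤ a.1.2 ∧ z = a.1.1 then some () else none : Option Unit) : Part Unit) :=
    Computable.ofOption h2.to_comp
  refine REPred.partrec_of_iff_dom (h1.bind h3) fun a => ?_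
  simp only [Part.dom_iff_mem, Part.mem_bind_iff, Part.mem_ofOption, Option.mem_def,
    Option.ite_none_right_eq_some]
  constructor
  · rintro ⟨-, z, hz, ⟨hl, rfl⟩, -⟩
    exact ⟨hl, hz⟩
  · rintro ⟨hl, hz⟩
    exact ⟨(), _, hz, ⟨hl, rfl⟩, trivial⟩

/-- A set of nonempty strings none of which is a prefix of another is uniquely decodable. -/
theorem uniquelyDecodable_of_prefixFree {S : Set BStr} (hnil : [] ∉ S)
    (hS : ∀ p ∈ S, ∀ q ∈ S, q <+: p → q = p) : InformationTheory.UniquelyDecodable S := by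
  intro L₁
  induction L₁ with
  | nil =>
    rintro (_ | ⟨w, L⟩) _ h₂ h
    · rfl
    · have : w = [] := by simp at h; exact h.1
      exact absurd (this ▸ h₂ w (by simp)) hnil
  | cons u L₁ ih =>
    rintro (_ | ⟨w, L⟩) h₁ h₂ h
    · have : u = [] := by simp at h; exact h.1
      exact absurd (this ▸ h₁ u (by simp)) hnil
    · have hu := h₁ u (by simp)
      have hw := h₂ w (by simp)
      simp only [List.flatten_cons] at h
      have huw : u = w := by
        rcases List.prefix_or_prefix_of_prefix (List.prefix_append u L₁.flatten)
          (h ▸ List.prefix_append w L.flatten) with h' | h'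
        · exact hS w hw u hu h'
        · exact (hS u hu w hw h').symm
      subst huw
      rw [ih L (fun z hz => h₁ z (by simp [hz])) (fun z hz => h₂ z (by simp [hz]))
        (List.append_cancel_left h)]

/-- The Kraft inequality for prefix complexity. -/
theorem IsOptimalPrefixFreeMachine.kraft (hV : IsOptimalPrefixFreeMachine V) (F : Finset BStr) :
    ∑ x ∈ F, (1 / 2 : ℝ) ^ (complexity V x).toNat ≤ 1 := by
  classical
  choose P hP hl using hV.exists_program
  have hinj : Function.Injective P := fun x x' h =>
    Part.mem_unique (hP x) (h ▸ hP x')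
  have hfree : ∀ p ∈ F.image P, ∀ q ∈ F.image P, q <+: p → q = p := by
    intro p hp q hq h
    obtain ⟨x, -, rfl⟩ := Finset.mem_image.1 hp
    obtain ⟨y, -, rfl⟩ := Finset.mem_image.1 hq
    exact hV.isPrefixFree.prefixFree _ _ [] (Part.dom_iff_mem.2 ⟨_, hP x⟩)
      (Part.dom_iff_mem.2 ⟨_, hP y⟩) h
  have hsum : ∑ x ∈ F, (1 / 2 : ℝ) ^ (complexity V x).toNat =
      ∑ p ∈ F.image P, (1 / 2 : ℝ) ^ p.length := by
    rw [Finset.sum_image hinj.injOn]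
    exact Finset.sum_congr rfl fun x _ => by rw [hl]
  rw [hsum]
  -- A code containing the empty word is not uniquely decodable, so Kraft–McMillan does not apply to
  -- it; prefix-freeness then leaves only that word.
  by_cases hnil : [] ∈ F.image P
  · have : F.image P = {[]} :=
      Finset.eq_singleton_iff_unique_mem.2
        ⟨hnil, fun p hp => (hfree p hp [] hnil List.nil_prefix).symm⟩
    simp [this]
  · have := InformationTheory.kraft_mcmillan_inequality (S := F.image P)
      (uniquelyDecodable_of_prefixFree (by exact_mod_cast hnil) (by exact_mod_cast hfree))
    simpa using this

end Complexity

/-! ### Strings of maximal complexity at every length -/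

theorem sum_half_pow_succ_le (k₀ : ℕ) (S : Finset ℕ) (hS : ∀ k ∈ S, k₀ ≤ k) :
    ∑ k ∈ S, (1 / 2 : ℝ) ^ (k + 1) ≤ (1 / 2) ^ k₀ := by
  have hsub : S ⊆ Finset.Ico k₀ (k₀ + (S.sup id + 1)) := fun k hk =>
    Finset.mem_Ico.2 ⟨hS k hk, by have := Finset.le_sup (f := id) hk; simp at this; omega⟩
  have hsum : ∀ N : ℕ, ∑ k ∈ Finset.Ico k₀ (k₀ + N), (1 / 2 : ℝ) ^ (k + 1) =
      (1 / 2) ^ k₀ - (1 / 2) ^ (k₀ + N) := by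
    intro N
    induction N with
    | zero => simp
    | succ N ih => rw [← add_assoc, Finset.sum_Ico_succ_top (by omega), ih]; ring
  refine (Finset.sum_le_sum_of_subset_of_nonneg hsub fun _ _ _ => by positivity).trans ?_
  rw [hsum]
  have : (0 : ℝ) ≤ (1 / 2) ^ (k₀ + (S.sup id + 1)) := by positivity
  linarith

section Maximal

variable {V : BStr → BStr →. BStr}

theorem IsOptimalPrefixFreeMachine.kraft_bitString (hV : IsOptimalPrefixFreeMachine V)
    (F : Finset ℕ) : ∑ n ∈ F, ∑ v ∈ Finset.range (2 ^ n),
      (1 / 2 : ℝ) ^ (complexity V (bitString n v)).toNat ≤ 1 := by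
  classical
  rw [Finset.sum_sigma']
  have hinj : Set.InjOn (fun a : (_ : ℕ) × ℕ => bitString a.1 a.2)
      (F.sigma fun n => Finset.range (2 ^ n) : Finset ((_ : ℕ) × ℕ)) := by
    rintro ⟨n, v⟩ h ⟨n', v'⟩ h' heq
    simp only [Finset.coe_sigma, Set.mem_sigma_iff, Finset.mem_coe, Finset.mem_range] at h h'
    have hn : n = n' := by
      have := congrArg List.length heq
      simpa [length_bitString] using this
    subst hn
    rw [bitString_injOn h.2 h'.2 heq]
  rw [← Finset.sum_image (f := fun x => (1 / 2 : ℝ) ^ (complexity V x).toNat) hinj]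
  exact hV.kraft _

/-- For fixed n, all k in play together weigh at most 2^(-k₀) with k₀ the least of them. The 2^n
strings of length n, each of complexity at most n + k₀, carry at least that much Kraft weight. -/
theorem IsOptimalPrefixFreeMachine.sum_pairs_le (hV : IsOptimalPrefixFreeMachine V)
    (P : Finset (ℕ × ℕ))
    (hP : ∀ a ∈ P, ∀ v < 2 ^ a.1, (complexity V (bitString a.1 v)).toNat ≤ a.1 + a.2) :
    ∑ a ∈ P, (1 / 2 : ℝ) ^ (a.2 + 1) ≤ 1 := by
  classical
  refine le_trans ?_ (hV.kraft_bitString (P.image Prod.fst))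
  rw [← Finset.sum_fiberwise_of_maps_to (fun a ha => Finset.mem_image_of_mem Prod.fst ha)]
  refine Finset.sum_le_sum fun n hn => ?_
  set Q := (P.filter fun a => a.1 = n).image Prod.snd with hQ
  have hsum : ∑ a ∈ P.filter (fun a => a.1 = n), (1 / 2 : ℝ) ^ (a.2 + 1) =
      ∑ k ∈ Q, (1 / 2 : ℝ) ^ (k + 1) := by
    rw [hQ, Finset.sum_image]
    rintro ⟨n, k⟩ h ⟨n', k'⟩ h' (rfl : k = k')
    simp at h h'
    rw [h.2, h'.2]
  have hne : Q.Nonempty := by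
    obtain ⟨a, ha, hn⟩ := Finset.mem_image.1 hn
    exact ⟨a.2, Finset.mem_image_of_mem _ (Finset.mem_filter.2 ⟨ha, hn⟩)⟩
  rw [hsum]
  refine (sum_half_pow_succ_le (Q.min' hne) Q fun k hk => Q.min'_le k hk).trans ?_
  obtain ⟨⟨n', k⟩, haQ, hk⟩ := Finset.mem_image.1 (Q.min'_mem hne)
  obtain ⟨ha, rfl⟩ := Finset.mem_filter.1 haQ
  rw [← hk]
  calc (1 / 2 : ℝ) ^ k = ∑ v ∈ Finset.range (2 ^ n'), (1 / 2 : ℝ) ^ (n' + k) := by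
        rw [Finset.sum_const, Finset.card_range, nsmul_eq_mul, pow_add, ← mul_assoc]
        push_cast
        rw [← mul_pow]; norm_num
    _ ≤ _ := Finset.sum_le_sum fun v hv => pow_le_pow_of_le_one (by norm_num) (by norm_num)
        (hP _ ha v (Finset.mem_range.1 hv))

/-- If every string of length `n` has complexity at most `n + k`, then `n` has complexity at most
`k` up to an additive constant. -/
theorem IsOptimalPrefixFreeMachine.exists_complexity_length_le (hV : IsOptimalPrefixFreeMachine V)
    {e : ℕ → BStr} (he : Computable e) :
    ∃ D : ℕ, ∀ n k : ℕ, (∀ x : BStr, x.length = n → (complexity V x).toNat ≤ n + k) →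
      (complexity V (e n)).toNat ≤ k + D := by
  classical
  have hre : REPred fun a : ℕ × ℕ =>
      ∀ v < 2 ^ a.1, (complexity V (bitString a.1 v)).toNat ≤ a.1 + a.2 := by
    refine REPred.forall_lt (f := fun a : ℕ × ℕ => 2 ^ a.1)
      (p := fun a v => (complexity V (bitString a.1 v)).toNat ≤ a.1 + a.2) ?_
      (primrec_two_pow.to_comp.comp Computable.fst)
    refine REPred.comp hV.rePred_complexity_le
      (f := fun ab : (ℕ × ℕ) × ℕ => (bitString ab.1.1 ab.2, ab.1.1 + ab.1.2)) ?_
    exact Computable.pair (computable_bitString.comp (Computable.fst.comp Computable.fst)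
      Computable.snd) (Primrec.nat_add.to_comp.comp (Computable.fst.comp Computable.fst)
      (Computable.snd.comp Computable.fst))
  obtain ⟨f, hf, hfp, hfu⟩ := hre.exists_stage
  let dec : ℕ → (ℕ × ℕ) × ℕ := Denumerable.ofNat ((ℕ × ℕ) × ℕ)
  have hdec : Computable dec := Computable.ofNat _
  -- Whenever a pair (n, k) is enumerated, a program of length k + 1 is requested for n. Uniqueness
  -- of stages ensures that each pair is paid for once.
  let g : ℕ → Option (BStr × ℕ) := fun t =>
    bif f (dec t).1 (dec t).2 then some (e (dec t).1.1, (dec t).1.2 + 1) else none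
  have hg : Computable g := by
    have h1 : Computable fun t => (dec t).1 := Computable.fst.comp hdec
    exact Computable.cond (hf.comp h1 (Computable.snd.comp hdec))
      (Computable.option_some.comp (Computable.pair (he.comp (Computable.fst.comp h1))
        (Computable.succ.comp (Computable.snd.comp h1)))) (Computable.const none)
  have hsum : ∀ T : ℕ, ∑ t ∈ Finset.range T, requestWeight (g t) ≤ 1 := by
    intro T
    set S := (Finset.range T).filter fun t => f (dec t).1 (dec t).2 = true with hS
    have h1 : ∑ t ∈ Finset.range T, requestWeight (g t) =
        ∑ t ∈ S, (1 / 2 : ℝ) ^ ((dec t).1.2 + 1) := by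
      rw [hS, Finset.sum_filter]
      refine Finset.sum_congr rfl fun t _ => ?_
      cases h : f (dec t).1 (dec t).2 <;> simp [g, h, requestWeight]
    have hinj : Set.InjOn (fun t => (dec t).1) S := by
      intro t ht t' ht' h
      have ht := (Finset.mem_filter.1 ht).2
      have ht' := (Finset.mem_filter.1 ht').2
      simp only at h
      rw [← h] at ht'
      have : dec t = dec t' := Prod.ext h (hfu _ _ _ ht ht')
      exact (Denumerable.eqv ((ℕ × ℕ) × ℕ)).symm.injective this
    rw [h1, ← Finset.sum_image (f := fun a : ℕ × ℕ => (1 / 2 : ℝ) ^ (a.2 + 1)) hinj]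
    refine hV.sum_pairs_le _ fun a ha => ?_
    obtain ⟨t, ht, rfl⟩ := Finset.mem_image.1 ha
    exact (hfp _).2 ⟨_, (Finset.mem_filter.1 ht).2⟩
  have hq : Partrec₂ fun (_ : ℕ) (t : ℕ) => Part.some (g t) := (hg.comp Computable.snd).partrec
  obtain ⟨U, hU, hUc⟩ := exists_prefixFreeMachine_of_requests hq
  obtain ⟨d, hd⟩ := hV.optimal U hU
  -- The 3 is the loss of 2 in serving sequence 0 plus the extra bit in the requested length k + 1.
  refine ⟨d + 3, fun n k hnk => ?_⟩
  obtain ⟨s, hs⟩ := (hfp (n, k)).1 fun v _ => hnk _ (length_bitString n v)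
  have hdt : dec (Encodable.encode ((n, k), s)) = ((n, k), s) := Denumerable.ofNat_encode _
  have h := hUc 0 (Encodable.encode ((n, k), s)) g (e n) (k + 1) (fun _ _ => Part.mem_some _)
    (hsum _) (by simp only [g, hdt]; simp [hs])
  have h2 : complexity V (e n) ≤ ((k + (d + 3) : ℕ) : ℕ∞) := by
    refine (hd (e n) []).trans ?_
    refine (add_le_add_left h (d : ℕ∞)).trans ?_
    exact_mod_cast (by omega)
  exact ENat.toNat_le_of_le_natCast h2

/-- There are strings of every length whose complexity is maximal up to a constant. -/
theorem IsOptimalPrefixFreeMachine.exists_mem_maximalComplexitySet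
    (hV : IsOptimalPrefixFreeMachine V) {e : ℕ → BStr} (he : Computable e) :
    ∃ c₀ : ℤ, ∀ c : ℤ, c₀ ≤ c → ∀ n : ℕ, ∃ x ∈ maximalComplexitySet V e c, x.length = n := by
  obtain ⟨D, hD⟩ := hV.exists_complexity_length_le he
  refine ⟨D, fun c hc n => ?_⟩
  by_contra! hcon
  have hlt : ∀ x : BStr, x.length = n →
      ((complexity V x).toNat : ℤ) < (complexity V (e n)).toNat + n - c := by
    intro x hx
    by_contra! h
    exact hcon x (by simpa [maximalComplexitySet, hx] using h) hx
  -- If K(n) > c, the preceding theorem with k = K(n) - c - 1 gives K(n) ≤ K(n) - c - 1 + D,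
  -- impossible for c ≥ D. Otherwise k would be negative and a direct count is used.
  by_cases hk : c + 1 ≤ (complexity V (e n)).toNat
  · have := hD n ((complexity V (e n)).toNat - (c + 1)).toNat fun x hx => by
      have := hlt x hx
      omega
    omega
  -- Here all 2^n strings have complexity below n, so their Kraft sum is at least 2.
  · have hlow : ∀ v, (complexity V (bitString n v)).toNat + 1 ≤ n := fun v => by
      have := hlt _ (length_bitString n v)
      omega
    have h1 := hV.kraft_bitString {n}
    rw [Finset.sum_singleton] at h1
    have h2 : ∑ v ∈ Finset.range (2 ^ n), (1 / 2 : ℝ) ^ n ≤ ∑ v ∈ Finset.range (2 ^ n),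
        (1 / 2 : ℝ) ^ ((complexity V (bitString n v)).toNat + 1) :=
      Finset.sum_le_sum fun v _ =>
        pow_le_pow_of_le_one (by norm_num) (by norm_num) (hlow v)
    have h3 : ∑ v ∈ Finset.range (2 ^ n), (1 / 2 : ℝ) ^ n = 1 := by
      rw [Finset.sum_const, Finset.card_range, nsmul_eq_mul]
      push_cast
      rw [← mul_pow]; norm_num
    rw [h3] at h2
    simp only [pow_succ, ← Finset.sum_mul] at h2
    linarith

end Maximal

/-! ### Tools for the game: waiting for one of two events, and geometric sums -/

/-- Both enumerations run in parallel. If both events occur either answer may be given; the game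
only needs the answer to be correct. -/
theorem REPred.exists_decision {α : Type*} [Primcodable α] {p q : α → Prop} (hp : REPred p)
    (hq : REPred q) : ∃ W : α →. Bool, Partrec W ∧
      ∀ a, (true ∈ W a → p a) ∧ (false ∈ W a → q a) ∧ (p a ∨ q a → (W a).Dom) := by
  obtain ⟨W, hW, h⟩ := Partrec.merge' (Partrec.map hp (Computable.const true).to₂)
    (Partrec.map hq (Computable.const false).to₂)
  refine ⟨W, hW, fun a => ⟨fun ht => ?_, fun hf => ?_, fun hd => (h a).2.2 ?_⟩⟩
  · rcases (h a).1 _ ht with h' | h'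
    · obtain ⟨⟨⟩, hu, -⟩ := (Part.mem_map_iff _).1 h'
      exact (Part.mem_assert_iff.1 hu).1
    · obtain ⟨⟨⟩, hu, hb⟩ := (Part.mem_map_iff _).1 h'
      simp at hb
  · rcases (h a).1 _ hf with h' | h'
    · obtain ⟨⟨⟩, hu, hb⟩ := (Part.mem_map_iff _).1 h'
      simp at hb
    · obtain ⟨⟨⟩, hu, -⟩ := (Part.mem_map_iff _).1 h'
      exact (Part.mem_assert_iff.1 hu).1
  · rcases hd with hd | hd
    · exact Or.inl ⟨hd, trivial⟩
    · exact Or.inr ⟨hd, trivial⟩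

theorem sum_two_pow_div (m M : ℕ) :
    ∑ v ∈ Finset.range (M * 2 ^ m), 2 ^ (v / 2 ^ m) + 2 ^ m = 2 ^ m * 2 ^ M := by
  induction M with
  | zero => simp
  | succ M ih =>
    have h : ∀ v ∈ Finset.range (2 ^ m), 2 ^ ((M * 2 ^ m + v) / 2 ^ m) = 2 ^ M := by
      intro v hv
      rw [mul_comm, Nat.mul_add_div (by positivity), Nat.div_eq_of_lt (Finset.mem_range.1 hv),
        add_zero]
    rw [add_mul, one_mul, Finset.sum_range_add, Finset.sum_congr rfl h, Finset.sum_const,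
      Finset.card_range, smul_eq_mul, pow_succ]
    linarith

/-- Each level has 2^m strings and so total 2^ℓ in these units; the geometric sum up to the current
level is below twice its last term. -/
theorem sum_half_pow_mul_two_pow_div_le (m v : ℕ) :
    ∑ u ∈ Finset.range (v + 1), (1 / 2 : ℝ) ^ m * 2 ^ (u / 2 ^ m) ≤ 2 ^ (v / 2 ^ m + 1) := by
  have hv : v + 1 ≤ (v / 2 ^ m + 1) * 2 ^ m := by
    rw [mul_comm]; exact Nat.lt_mul_div_succ v (by positivity)
  have h1 : ∑ u ∈ Finset.range (v + 1), 2 ^ (u / 2 ^ m) ≤ 2 ^ m * 2 ^ (v / 2 ^ m + 1) := by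
    refine (Finset.sum_le_sum_of_subset (Finset.range_mono hv)).trans ?_
    rw [← sum_two_pow_div m (v / 2 ^ m + 1)]
    exact Nat.le_add_right _ _
  have h2 : ∑ u ∈ Finset.range (v + 1), (2 : ℝ) ^ (u / 2 ^ m) ≤ 2 ^ m * 2 ^ (v / 2 ^ m + 1) := by
    exact_mod_cast h1
  rw [← Finset.mul_sum]
  calc (1 / 2 : ℝ) ^ m * ∑ u ∈ Finset.range (v + 1), (2 : ℝ) ^ (u / 2 ^ m)
      ≤ (1 / 2 : ℝ) ^ m * (2 ^ m * 2 ^ (v / 2 ^ m + 1)) := by gcongr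
    _ = 2 ^ (v / 2 ^ m + 1) := by rw [← mul_assoc, ← mul_pow]; norm_num

/-! ### The game on lengths -/

namespace LengthGame

/-! For each `d`, the game is played on the lengths `N + excess C d + j` for `j = 0, 1, …` in turn.
On each length the strings are requested one after another, with shorter and shorter programs; one
moves to the next string once the current one has left the set, and to the next length once its
complexity has become small. -/

/-- The logarithm of the number of levels in each round of the game. -/
def excess (C d : ℕ) : ℕ := 2 * d + C + 4

/-- The requested length of programs at the first level of a round, up to a shift. -/
def budget (C d : ℕ) : ℕ := 2 ^ excess C d + 1

/-- The length of strings considered in round `j`. -/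
def len (N C d j : ℕ) : ℕ := N + excess C d + j

/-- The level of the `v`-th string in round `j`. -/
def level (N j v : ℕ) : ℕ := v / 2 ^ (N + j)

/-- The request made in the state `s`, which consists of a round and the index of a string. -/
def request (N C d : ℕ) (s : ℕ × ℕ) : BStr × ℕ :=
  (bitString (len N C d s.1) s.2, budget C d + (N + s.1) - level N s.1 s.2)

/-- The state after `t` moves, where the moves are determined by `W`. -/
def state (W : ℕ × (ℕ × ℕ) →. Bool) (d t : ℕ) : Part (ℕ × ℕ) :=
  t.rec (Part.some (0, 0)) fun _ IH => IH.bind fun s =>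
    (W (d, s)).map fun b => bif b then (s.1 + 1, 0) else (s.1, s.2 + 1)

theorem computable_excess (C : ℕ) : Computable (excess C) :=
  (Primrec.nat_add.comp (Primrec.nat_add.comp (Primrec.nat_mul.comp (Primrec.const 2) Primrec.id)
    (Primrec.const C)) (Primrec.const 4)).to_comp

theorem computable_budget (C : ℕ) : Computable (budget C) :=
  Computable.succ.comp (primrec_two_pow.to_comp.comp (computable_excess C))

theorem computable_len (N C : ℕ) : Computable fun a : ℕ × (ℕ × ℕ) => len N C a.1 a.2.1 :=
  Primrec.nat_add.to_comp.comp (Primrec.nat_add.to_comp.comp (Computable.const N)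
    ((computable_excess C).comp Computable.fst)) (Computable.fst.comp Computable.snd)

theorem computable_level (N : ℕ) : Computable fun a : ℕ × (ℕ × ℕ) => level N a.2.1 a.2.2 :=
  Primrec.nat_div.to_comp.comp (Computable.snd.comp Computable.snd)
    (primrec_two_pow.to_comp.comp (Primrec.nat_add.to_comp.comp (Computable.const N)
      (Computable.fst.comp Computable.snd)))

theorem computable_request (N C : ℕ) :
    Computable fun a : ℕ × (ℕ × ℕ) => request N C a.1 a.2 :=
  Computable.pair
    (computable_bitString.comp (computable_len N C) (Computable.snd.comp Computable.snd))
    (Primrec.nat_sub.to_comp.comp (Primrec.nat_add.to_comp.comp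
      ((computable_budget C).comp Computable.fst) (Primrec.nat_add.to_comp.comp
        (Computable.const N) (Computable.fst.comp Computable.snd))) (computable_level N))

theorem partrec_state {W : ℕ × (ℕ × ℕ) →. Bool} (hW : Partrec W) : Partrec₂ (state W) := by
  have h1 : Partrec fun a : (ℕ × ℕ) × (ℕ × (ℕ × ℕ)) => W (a.1.1, a.2.2) :=
    hW.comp (Computable.pair (Computable.fst.comp Computable.fst)
      (Computable.snd.comp Computable.snd))
  have hs : Computable fun a : ((ℕ × ℕ) × (ℕ × (ℕ × ℕ))) × Bool => a.1.2.2 :=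
    Computable.snd.comp (Computable.snd.comp Computable.fst)
  have h2 : Computable₂ fun (a : (ℕ × ℕ) × (ℕ × (ℕ × ℕ))) (b : Bool) =>
      bif b then (a.2.2.1 + 1, 0) else (a.2.2.1, a.2.2.2 + 1) :=
    Computable.cond Computable.snd
      (Computable.pair (Computable.succ.comp (Computable.fst.comp hs)) (Computable.const 0))
      (Computable.pair (Computable.fst.comp hs) (Computable.succ.comp (Computable.snd.comp hs)))
  exact Partrec.nat_rec (f := fun a : ℕ × ℕ => a.2) (g := fun _ => Part.some (0, 0))
    (h := fun a b => (W (a.1, b.2)).map fun c => bif c then (b.2.1 + 1, 0) else (b.2.1, b.2.2 + 1))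
    Computable.snd (Computable.const _).partrec (h1.map h2)

theorem state_zero (W : ℕ × (ℕ × ℕ) →. Bool) (d : ℕ) : (0, 0) ∈ state W d 0 := Part.mem_some _

theorem mem_state_succ {W : ℕ × (ℕ × ℕ) →. Bool} {d t : ℕ} {s : ℕ × ℕ} {b : Bool}
    (hs : s ∈ state W d t) (hb : b ∈ W (d, s)) :
    (bif b then (s.1 + 1, 0) else (s.1, s.2 + 1)) ∈ state W d (t + 1) :=
  Part.mem_bind hs (Part.mem_map (fun b => bif b then (s.1 + 1, 0) else (s.1, s.2 + 1)) hb)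

theorem partrec_request_state (N C : ℕ) {W : ℕ × (ℕ × ℕ) →. Bool} (hW : Partrec W) :
    Partrec₂ fun d t => (state W d t).map fun s => some (request N C d s) := by
  have h1 : Computable fun a : (ℕ × ℕ) × (ℕ × ℕ) => (a.1.1, a.2) :=
    Computable.pair (Computable.fst.comp Computable.fst) Computable.snd
  have h2 : Computable fun a : (ℕ × ℕ) × (ℕ × ℕ) => request N C a.1.1 a.2 :=
    ((computable_request N C).comp h1).of_eq fun _ => rfl
  have h3 : Computable₂ fun (a : ℕ × ℕ) (s : ℕ × ℕ) => some (request N C a.1 s) :=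
    Computable.option_some.comp h2
  exact (partrec_state hW).map h3

variable {V : BStr → BStr →. BStr}

/-- The event that ends a round. -/
def IsCheap (V : BStr → BStr →. BStr) (e : ℕ → BStr) (N C : ℕ) (a : ℕ × (ℕ × ℕ)) : Prop :=
  (complexity V (e (len N C a.1 a.2.1))).toNat ≤ budget C a.1 - (2 + level N a.2.1 a.2.2)

theorem rePred_isCheap (hV : IsOptimalPrefixFreeMachine V) {e : ℕ → BStr} (he : Computable e)
    (N C : ℕ) : REPred (IsCheap V e N C) := by
  have h1 : Computable fun a : ℕ × (ℕ × ℕ) => e (len N C a.1 a.2.1) := he.comp (computable_len N C)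
  have h2 : Computable fun a : ℕ × (ℕ × ℕ) => budget C a.1 - (2 + level N a.2.1 a.2.2) :=
    Primrec.nat_sub.to_comp.comp ((computable_budget C).comp Computable.fst)
      (Primrec.nat_add.to_comp.comp (Computable.const 2) (computable_level N))
  exact (REPred.comp hV.rePred_complexity_le (h1.pair h2)).of_eq fun _ => Iff.rfl

/-- The invariant of the game: `S` is the total weight of the requests made so far. -/
structure Invariant (V : BStr → BStr →. BStr) (e : ℕ → BStr) (A : Set BStr) (N C d t : ℕ)
    (S : ℝ) (s : ℕ × ℕ) : Prop where
  index_lt : s.2 < 2 ^ len N C d s.1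
  removed : ∀ v < s.2, bitString (len N C d s.1) v ∉ A
  cheap : ∀ j < s.1, (complexity V (e (len N C d j))).toNat ≤ budget C d
  weight_le : S ≤ 1 / 2 * ∑ j ∈ Finset.range s.1,
      (1 / 2 : ℝ) ^ (complexity V (e (len N C d j))).toNat +
    (1 / 2) ^ budget C d * ∑ v ∈ Finset.range s.2, (1 / 2 : ℝ) ^ (N + s.1) * 2 ^ level N s.1 v
  time_le : t ≤ ∑ j ∈ Finset.range s.1, 2 ^ len N C d j + s.2

/-- A length has 2^E levels of 2^(N+j) strings. Consequently 2 + level never exceeds `budget`, and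
the truncated subtractions in the game are genuine. -/
theorem level_lt {N C d : ℕ} {s : ℕ × ℕ} (h : s.2 < 2 ^ len N C d s.1) :
    level N s.1 s.2 < 2 ^ excess C d := by
  refine Nat.div_lt_of_lt_mul ?_
  rw [← pow_add]
  convert h using 2
  simp only [len]; ring

theorem kraft_len (hV : IsOptimalPrefixFreeMachine V) {e : ℕ → BStr}
    (he_inj : Function.Injective e) (N C d J : ℕ) :
    ∑ j ∈ Finset.range J, (1 / 2 : ℝ) ^ (complexity V (e (len N C d j))).toNat ≤ 1 := by
  classical
  have hinj : Function.Injective fun j => e (len N C d j) := fun j j' h => by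
    have := he_inj h
    simpa [len] using this
  rw [← Finset.sum_image (f := fun x => (1 / 2 : ℝ) ^ (complexity V x).toNat) hinj.injOn]
  exact hV.kraft _

variable {e : ℕ → BStr} {A : Set BStr} {N C d t : ℕ} {S : ℝ} {s : ℕ × ℕ}

theorem requestWeight_request (h : s.2 < 2 ^ len N C d s.1) :
    requestWeight (some (request N C d s)) =
      (1 / 2) ^ budget C d * ((1 / 2 : ℝ) ^ (N + s.1) * 2 ^ level N s.1 s.2) := by
  have hl := level_lt h
  have hb : level N s.1 s.2 ≤ budget C d + (N + s.1) := by unfold budget; omega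
  simp only [requestWeight, request]
  rw [← mul_assoc, ← pow_add]
  obtain ⟨r, hr⟩ := Nat.exists_eq_add_of_le hb
  rw [hr, Nat.add_sub_cancel_left, pow_add, mul_right_comm, ← mul_pow]
  norm_num

theorem Invariant.weight_add_le (h : Invariant V e A N C d t S s) :
    S + requestWeight (some (request N C d s)) ≤ 1 / 2 * ∑ j ∈ Finset.range s.1,
      (1 / 2 : ℝ) ^ (complexity V (e (len N C d j))).toNat +
    (1 / 2) ^ budget C d *
      ∑ v ∈ Finset.range (s.2 + 1), (1 / 2 : ℝ) ^ (N + s.1) * 2 ^ level N s.1 v := by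
  rw [Finset.sum_range_succ, mul_add, requestWeight_request h.index_lt]
  linarith [h.weight_le]

/-- Finished rounds use at most half the Kraft sum of their lengths; the current one uses at most
2^(2^E - b) = 1/2. -/
theorem Invariant.weight_add_le_one (hV : IsOptimalPrefixFreeMachine V)
    (he_inj : Function.Injective e) (h : Invariant V e A N C d t S s) :
    S + requestWeight (some (request N C d s)) ≤ 1 := by
  have h1 := h.weight_add_le
  have h2 := kraft_len hV he_inj N C d s.1
  have h3 := sum_half_pow_mul_two_pow_div_le (N + s.1) s.2
  have h4 : (2 : ℝ) ^ (s.2 / 2 ^ (N + s.1) + 1) ≤ 2 ^ (2 ^ excess C d) :=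
    pow_le_pow_right₀ (by norm_num) (level_lt h.index_lt)
  have h5 : (1 / 2 : ℝ) ^ budget C d * ∑ v ∈ Finset.range (s.2 + 1),
      (1 / 2 : ℝ) ^ (N + s.1) * 2 ^ level N s.1 v ≤
      (1 / 2 : ℝ) ^ budget C d * 2 ^ (2 ^ excess C d) := by
    gcongr
    exact h3.trans h4
  have h6 : (1 / 2 : ℝ) ^ budget C d * 2 ^ (2 ^ excess C d) = 1 / 2 := by
    rw [budget, pow_succ, mul_right_comm, ← mul_pow]; norm_num
  linarith

/-- The weight of the round just ended is at most 2^(ℓ+1-b), and cheapness at level ℓ makes this at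
most half of 2^(-K(n)). The 2 in `IsCheap` pays for the geometric sum and for this half. -/
theorem Invariant.next_round (h : Invariant V e A N C d t S s) (hc : IsCheap V e N C (d, s)) :
    Invariant V e A N C d (t + 1) (S + requestWeight (some (request N C d s))) (s.1 + 1, 0) where
  index_lt := by positivity
  removed := by simp
  cheap j hj := by
    rcases Nat.lt_succ_iff_lt_or_eq.1 hj with hj | rfl
    · exact h.cheap j hj
    · exact hc.trans (Nat.sub_le _ _)
  weight_le := by
    have h1 := h.weight_add_le
    have h3 := sum_half_pow_mul_two_pow_div_le (N + s.1) s.2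
    have hl := level_lt h.index_lt
    have h4 : (1 / 2 : ℝ) ^ budget C d * 2 ^ (level N s.1 s.2 + 1) ≤
        1 / 2 * (1 / 2 : ℝ) ^ (complexity V (e (len N C d s.1))).toNat := by
      have hb : 2 + level N s.1 s.2 ≤ budget C d := by unfold budget; omega
      refine le_trans (le_of_eq ?_) (mul_le_mul_of_nonneg_left
        (pow_le_pow_of_le_one (by norm_num) (by norm_num) hc) (by norm_num))
      obtain ⟨r, hr⟩ := Nat.exists_eq_add_of_le hb
      simp only
      rw [hr, Nat.add_sub_cancel_left, pow_add, pow_add, pow_succ]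
      have : (1 / 2 : ℝ) ^ level N s.1 s.2 * 2 ^ level N s.1 s.2 = 1 := by
        rw [← mul_pow]; norm_num
      linear_combination (1 / 2 * (1 / 2 : ℝ) ^ r) * this
    have h5 : (1 / 2 : ℝ) ^ budget C d * ∑ v ∈ Finset.range (s.2 + 1),
        (1 / 2 : ℝ) ^ (N + s.1) * 2 ^ level N s.1 v ≤
        (1 / 2 : ℝ) ^ budget C d * 2 ^ (level N s.1 s.2 + 1) := by
      gcongr
      exact h3
    rw [Finset.sum_range_succ]
    simp only [Finset.range_zero, Finset.sum_empty, mul_zero, add_zero]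
    linarith
  time_le := by
    have h1 := h.time_le
    have h2 := h.index_lt
    rw [Finset.sum_range_succ]
    omega

/-- The index cannot run past the last string, since then every string of this length would have
left `A`. -/
theorem Invariant.next_string (h : Invariant V e A N C d t S s)
    (hA : ∀ n, N ≤ n → ∃ x ∈ A, x.length = n) (hr : (request N C d s).1 ∉ A) :
    Invariant V e A N C d (t + 1) (S + requestWeight (some (request N C d s)))
      (s.1, s.2 + 1) := by
  have hrem : ∀ v < s.2 + 1, bitString (len N C d s.1) v ∉ A := by
    intro v hv
    rcases Nat.lt_succ_iff_lt_or_eq.1 hv with hv | rfl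
    · exact h.removed v hv
    · exact hr
  refine ⟨?_, hrem, h.cheap, h.weight_add_le, ?_⟩
  · by_contra! hlt
    obtain ⟨x, hx, hxl⟩ := hA (len N C d s.1) (by unfold len; omega)
    obtain ⟨v, hv, hvx⟩ := exists_bitString_eq x
    rw [hxl] at hv hvx
    exact hrem v (lt_of_lt_of_le hv hlt) (hvx ▸ hx)
  · have := h.time_le
    simp only at *
    omega

/-- Each finished length contributes at least 2^(-b) to a Kraft sum, so at most 2^b rounds finish,
and each round has at most as many moves as there are strings. -/
theorem Invariant.time_lt (hV : IsOptimalPrefixFreeMachine V) (he_inj : Function.Injective e)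
    (h : Invariant V e A N C d t S s) :
    t < ∑ j ∈ Finset.range (2 ^ budget C d + 1), 2 ^ len N C d j := by
  have h1 : (s.1 : ℝ) * (1 / 2) ^ budget C d ≤ 1 := by
    refine le_trans ?_ (kraft_len hV he_inj N C d s.1)
    rw [← nsmul_eq_mul, ← Finset.card_range s.1, ← Finset.sum_const, Finset.card_range]
    exact Finset.sum_le_sum fun j hj => pow_le_pow_of_le_one (by norm_num) (by norm_num)
      (h.cheap j (Finset.mem_range.1 hj))
  have h2 : s.1 ≤ 2 ^ budget C d := by
    rw [one_div, inv_pow, ← div_eq_mul_inv, div_le_one (by positivity)] at h1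
    exact_mod_cast h1
  calc t ≤ ∑ j ∈ Finset.range s.1, 2 ^ len N C d j + s.2 := h.time_le
    _ < ∑ j ∈ Finset.range (s.1 + 1), 2 ^ len N C d j := by
        rw [Finset.sum_range_succ]; have := h.index_lt; omega
    _ ≤ _ := Finset.sum_le_sum_of_subset (Finset.range_mono (by omega))

end LengthGame

/-! ### The game refutes co-enumerability -/

open LengthGame in
/-- A co-enumerable set that contains a string of every sufficiently large length contains strings
whose complexity is not maximal. -/
theorem IsOptimalPrefixFreeMachine.exists_complexity_add_lt {V : BStr → BStr →. BStr}
    (hV : IsOptimalPrefixFreeMachine V) {e : ℕ → BStr} (he : Computable e)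
    (he_inj : Function.Injective e) {A : Set BStr} (hA : CoEnumerable A) {N : ℕ}
    (hN : ∀ n, N ≤ n → ∃ x ∈ A, x.length = n) (C : ℕ) :
    ∃ x ∈ A, (complexity V x).toNat + C < (complexity V (e x.length)).toNat + x.length := by
  by_contra! hcon
  have hR : Computable fun a : ℕ × (ℕ × ℕ) => (request N C a.1 a.2).1 :=
    Computable.fst.comp (computable_request N C)
  have hrem : REPred fun a : ℕ × (ℕ × ℕ) => (request N C a.1 a.2).1 ∉ A :=
    (REPred.comp hA hR).of_eq fun _ => Iff.rfl
  obtain ⟨W, hW, hWs⟩ := (rePred_isCheap hV he N C).exists_decision hrem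
  have hq := partrec_request_state N C hW
  obtain ⟨U, hU, hUc⟩ := exists_prefixFreeMachine_of_requests hq
  -- The machine plays the games for all d at once, so d can now be its own optimality constant; no
  -- fixed-point theorem is needed.
  obtain ⟨d, hd⟩ := hV.optimal U hU
  classical
  -- The default value is never relevant: `key` shows that every state is defined.
  let σ : ℕ → ℕ × ℕ := fun t => if h : (state W d t).Dom then (state W d t).get h else (0, 0)
  have hσ : ∀ {t s}, s ∈ state W d t → σ t = s := by
    rintro t s ⟨h, rfl⟩
    simp [σ, h]
  let g : ℕ → Option (BStr × ℕ) := fun t => some (request N C d (σ t))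
  have key : ∀ t, (∀ t' ≤ t, σ t' ∈ state W d t') ∧
      Invariant V e A N C d t (∑ t' ∈ Finset.range t, requestWeight (g t')) (σ t) := by
    intro t
    induction t with
    | zero =>
      have h0 := state_zero W d
      refine ⟨fun t' ht' => ?_, ?_⟩
      · obtain rfl : t' = 0 := by omega
        rwa [hσ h0]
      · rw [hσ h0]
        exact ⟨by positivity, by simp, by simp, by simp, by simp⟩
    | succ t ih =>
      obtain ⟨hst, hinv⟩ := ih
      have hsum := hinv.weight_add_le_one hV he_inj
      have hsucc : ∑ t' ∈ Finset.range (t + 1), requestWeight (g t') =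
          ∑ t' ∈ Finset.range t, requestWeight (g t') +
            requestWeight (some (request N C d (σ t))) := Finset.sum_range_succ _ _
      -- If the string is still in `A`, serving the request gives K(x) ≤ 2d + 2 + b + (N+j) - ℓ.
      -- Subtracting |x| = N + 2d + C + 4 + j and adding C leaves K(|x|) ≤ b - 2 - ℓ, which is
      -- cheapness; this fixes the choice of `excess`.
      have hdom : IsCheap V e N C (d, σ t) ∨ (request N C d (σ t)).1 ∉ A := by
        by_contra! hno
        obtain ⟨hnc, hmem⟩ := hno
        have hcx := hUc d t g (request N C d (σ t)).1 (request N C d (σ t)).2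
          (fun t' ht' => Part.mem_map (fun s => some (request N C d s)) (hst t' ht'))
          (hsucc ▸ hsum) rfl
        have hc1 : complexity V (request N C d (σ t)).1 ≤
            ((d + (request N C d (σ t)).2 + 2 + d : ℕ) : ℕ∞) := by
          refine (hd _ []).trans ?_
          rw [Nat.cast_add (_ + 2)]
          exact add_le_add_left hcx _
        have hc2 := ENat.toNat_le_of_le_natCast hc1
        have hc3 := hcon _ hmem
        have hl := level_lt hinv.index_lt
        have hlen : (request N C d (σ t)).1.length = len N C d (σ t).1 := length_bitString _ _
        rw [hlen] at hc3
        refine hnc ?_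
        simp only [IsCheap]
        have h2 : (request N C d (σ t)).2 = budget C d + (N + (σ t).1) - level N (σ t).1 (σ t).2 :=
          rfl
        have h3 : len N C d (σ t).1 = N + (2 * d + C + 4) + (σ t).1 := rfl
        have h4 : budget C d = 2 ^ excess C d + 1 := rfl
        omega
      obtain ⟨b, hb⟩ := Part.dom_iff_mem.1 ((hWs (d, σ t)).2.2 hdom)
      have hnext := mem_state_succ (hst t le_rfl) hb
      refine ⟨fun t' ht' => ?_, ?_⟩
      · rcases Nat.le_succ_iff.1 ht' with ht' | rfl
        · exact hst t' ht'
        · rwa [hσ hnext]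
      · rw [hσ hnext, hsucc]
        cases b with
        | true => exact hinv.next_round ((hWs _).1 hb)
        | false => exact hinv.next_string hN ((hWs _).2.1 hb)
  -- The time is taken equal to the bound on the number of moves.
  exact lt_irrefl _ ((key _).2.time_lt hV he_inj)

theorem mainTheorem6 (V : BStr → BStr →. BStr) (hV : IsOptimalPrefixFreeMachine V)
    (e : ℕ → BStr) (he : Computable e) (he_inj : Function.Injective e) :
    (∃ c₀ : ℤ, ∀ c : ℤ, c₀ ≤ c → ¬ CoEnumerable (maximalComplexitySet V e c)) ∧
    (∀ c : ℤ,
      (∃ N : ℕ, ∀ n : ℕ, N ≤ n → ∃ x ∈ maximalComplexitySet V e c, x.length = n) →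
        ¬ CoEnumerable (maximalComplexitySet V e c)) := by
  have hmain : ∀ c : ℤ,
      (∃ N : ℕ, ∀ n : ℕ, N ≤ n → ∃ x ∈ maximalComplexitySet V e c, x.length = n) →
        ¬ CoEnumerable (maximalComplexitySet V e c) := by
    rintro c ⟨N, hN⟩ hco
    -- For negative c the constant 0 suffices, since membership is then a stronger condition than
    -- for c = 0.
    obtain ⟨x, hx, hlt⟩ := hV.exists_complexity_add_lt he he_inj hco hN c.toNat
    simp only [maximalComplexitySet, Set.mem_ofPred_eq] at hx
    omega
  refine ⟨?_, hmain⟩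
  obtain ⟨c₀, hc₀⟩ := hV.exists_mem_maximalComplexitySet he
  exact ⟨c₀, fun c hc => hmain c ⟨0, fun n _ => hc₀ c hc n⟩⟩
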